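/- Let $n \ge 2$ and let $\mathcal M = (M_1,\dots,M_{2n-2})$ be a family of (not necessarily distinct) matchings in a bipartite graph, each consisting of exactly $n$ edges. A rainbow matching of size $n$ for $\mathcal M$ is a set of $n$ pairwise disjoint edges that is the range of an injective partial choice function of $\mathcal M$; that is, a matching $\{e_1,\dots,e_n\}$ such that $e_j \in M_{i_j}$ for suitable distinct indices $i_1,\dots,i_n$. If $\mathcal M$ has no rainbow matching of size $n$, then $\bigcup_{i} M_i$ is the edge set of a cycle of length $2n$; moreover, numbering the edges of this cycle consecutively, exactly half (that is, $n-1$) of the indices $i$ satisfy that $M_i$ is the matching of all even-numbered edges of the cycle, and for each of the other $n-1$ indices $M_i$ is the matching of all odd-numbered edges. -/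

import Mathlib

/-- `S` is a rainbow set for the system of sets `C`: it is the range of an injective partial
choice function of `C`, with domain `D`. -/
def IsRainbowSet {ι α : Type*} (C : ι → Set α) (S : Set α) : Prop :=
  ∃ (D : Set ι) (φ : D → α),
    Function.Injective φ ∧ (∀ i : D, φ i ∈ C i) ∧ Set.range φ = S

namespace SimpleGraph

/-- The family `M` of matchings of `G` has a (partial) rainbow matching of size `k`. -/
def HasRainbowMatching {V ι : Type*} {G : SimpleGraph V} (M : ι → G.Subgraph) (k : ℕ) : Prop :=
  ∃ R : G.Subgraph, R.IsMatching ∧ R.edgeSet.ncard = k ∧ R.edgeSet.Finite ∧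
    IsRainbowSet (fun i => (M i).edgeSet) R.edgeSet

/-- The edges of a walk in even positions, where the positions are `0, 1, 2, …`. -/
def Walk.evenEdges {V : Type*} {G : SimpleGraph V} {u v : V} (c : G.Walk u v) : Set (Sym2 V) :=
  {e | ∃ k : ℕ, Even k ∧ c.edges[k]? = some e}

/-- The edges of a walk in odd positions, where the positions are `0, 1, 2, …`. -/
def Walk.oddEdges {V : Type*} {G : SimpleGraph V} {u v : V} (c : G.Walk u v) : Set (Sym2 V) :=
  {e | ∃ k : ℕ, Odd k ∧ c.edges[k]? = some e}

end SimpleGraph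

/-! Write n = k + 1, take a rainbow matching `F` of size k, contract each of its edges to a point,
and merge all uncovered vertices into one point o. Each of the k unused matchings becomes a relation
on these k + 1 points, leading from the left end of one edge to the right end of another. A closed
walk through o with distinct unused colours is an augmenting walk and would yield a rainbow matching
of size k + 1, so there is none.

Two facts about such systems carry the proof. Each further colour allows one more point to be
reached from o, so there are at most as many colours as points other than o (`PathSystem.card_le`);
this also produces `F`. In the case of equality, which holds here, every relation is a permutation,
and if some point carries no loop of any colour, all relations are one and the same Hamiltonian
cycle (`PathSystem.exists_list`).

A loopless point is an edge of `F` lying in no unused matching; `F` is then tight. A tight `F` is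
found by raising the number of its edges that lie in one fixed matching whose colour it uses. For
tight `F` the unused matchings coincide. Shifting `F` along them gives a tight matching whose unused
colours are exactly those used by `F`, so these k matchings coincide as well. The Hamiltonian cycle
of the second contraction says how the two common matchings interlock: they alternate along a cycle
of length 2n. -/

/-! ### Rainbow walks and contraction of the source -/

/-- `RainbowReach E o T x`: there is a walk from `o` to `x`, not returning to `o`, whose edges have
distinct colours forming the set `T`. -/
inductive RainbowReach {ι P : Type*} [DecidableEq ι] (E : ι → P → P → Prop) (o : P) :
    Finset ι → P → Prop
  | single {i : ι} {x : P} : E i o x → x ≠ o → RainbowReach E o {i} x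
  | step {T : Finset ι} {i : ι} {x y : P} :
      RainbowReach E o T x → i ∉ T → E i x y → y ≠ o → RainbowReach E o (insert i T) y

/-- A family of relations on `insert o X`, indexed by `K`, each with in- and out-degrees at most one
on `X` and more than `X.card` edges, and without a rainbow closed walk through `o`. -/
structure PathSystem {ι P : Type*} [DecidableEq ι] [DecidableEq P]
    (E : ι → P → P → Prop) (o : P) (X : Finset P) (K : Finset ι) : Prop where
  notMem : o ∉ X
  supp : ∀ i ∈ K, ∀ u w, E i u w → u ∈ insert o X ∧ w ∈ insert o X
  out_unique : ∀ i ∈ K, ∀ u ∈ X, ∀ w w', E i u w → E i u w' → w = w'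
  in_unique : ∀ i ∈ K, ∀ w ∈ X, ∀ u u', E i u w → E i u' w → u = u'
  exists_edges : ∀ i ∈ K, ∃ S : Finset (P × P), X.card + 1 ≤ S.card ∧ ∀ p ∈ S, E i p.1 p.2
  no_direct : ∀ i ∈ K, ¬ E i o o
  no_rainbow : ∀ T ⊆ K, ∀ x, RainbowReach E o T x → ∀ i ∈ K, i ∉ T → ¬ E i x o

/-- Merge the vertex `v` into the source `o`. -/
def contractSource {ι P : Type*} (E : ι → P → P → Prop) (o v : P) : ι → P → P → Prop :=
  fun i u w => u ≠ v ∧ w ≠ v ∧ (E i u w ∨ (u = o ∧ E i v w))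

namespace RainbowReach

variable {ι P : Type*} [DecidableEq ι] {E : ι → P → P → Prop} {o : P}

theorem ne {T : Finset ι} {x : P} (h : RainbowReach E o T x) : x ≠ o := by
  cases h <;> assumption

/-- Only the first edge of the walk can start at `o`. If it really starts at `v`, the edge of colour
`j` from `o` to `v` is put in front. -/
theorem of_contractSource {v : P} {j : ι} (hj : E j o v) (hv : v ≠ o) {T : Finset ι} {x : P}
    (h : RainbowReach (contractSource E o v) o T x) (hT : j ∉ T) :
    RainbowReach E o T x ∨ RainbowReach E o (insert j T) x := by
  induction h with
  | @single i x h hx =>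
    obtain ⟨h1, h2, h | ⟨-, h⟩⟩ := h
    · exact Or.inl (.single h hx)
    · right
      have := RainbowReach.step (RainbowReach.single hj hv) (i := i)
        (by simpa [eq_comm] using hT) h hx
      rwa [Finset.pair_comm] at this
  | @step T i x y hr hi h hy ih =>
    simp only [Finset.mem_insert, not_or] at hT
    obtain ⟨h1, h2, h | ⟨h, -⟩⟩ := h
    · rcases ih hT.2 with ih | ih
      · exact Or.inl (ih.step hi h hy)
      · right
        rw [Finset.insert_comm]
        refine ih.step ?_ h hy
        simp only [Finset.mem_insert, not_or]
        exact ⟨fun e => hT.1 e.symm, hi⟩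
    · exact absurd h hr.ne

end RainbowReach

namespace PathSystem

variable {ι P : Type*} [DecidableEq ι] [DecidableEq P] {E : ι → P → P → Prop} {o : P}
  {X : Finset P} {K : Finset ι}

theorem mem_of_edge_source (h : PathSystem E o X K) {i : ι} (hi : i ∈ K) {w : P}
    (he : E i o w) : w ∈ X := by
  rcases Finset.mem_insert.1 (h.supp i hi _ _ he).2 with rfl | hw
  · exact absurd he (h.no_direct i hi)
  · exact hw

theorem mem_of_edge_target (h : PathSystem E o X K) {i : ι} (hi : i ∈ K) {u : P}
    (he : E i u o) : u ∈ X := by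
  rcases Finset.mem_insert.1 (h.supp i hi _ _ he).1 with rfl | hw
  · exact absurd he (h.no_direct i hi)
  · exact hw

-- Each new colour reaches a new vertex: if its edges from `o` and the reached set `R` all ended in
-- `R`, it would have at most `R.card` edges into `R` and at most `(X \ R).card` others, fewer than
-- required.
open Classical in
theorem card_le_card_reach (h : PathSystem E o X K) {T : Finset ι} (hT : T ⊆ K) :
    T.card ≤ (X.filter fun x => ∃ T' ⊆ T, RainbowReach E o T' x).card := by
  induction T using Finset.induction_on with
  | empty => simp
  | @insert j T hj ih =>
    have hjK : j ∈ K := hT (Finset.mem_insert_self _ _)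
    have hTK : T ⊆ K := (Finset.subset_insert _ _).trans hT
    specialize ih hTK
    set R := X.filter fun x => ∃ T' ⊆ T, RainbowReach E o T' x with hR
    have hRX : R ⊆ X := Finset.filter_subset _ _
    obtain ⟨u, w, he, hu, hw⟩ : ∃ u w, E j u w ∧ u ∈ insert o R ∧ w ∉ R := by
      by_contra! hcon
      obtain ⟨S, hS, hSE⟩ := h.exists_edges j hjK
      have h1 : (S.filter fun p => p.2 ∈ R).card ≤ R.card := by
        refine Finset.card_le_card_of_injOn Prod.snd (fun p hp => (Finset.mem_filter.1 hp).2) ?_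
        intro p hp q hq hpq
        have hp := Finset.mem_filter.1 hp
        have hq := Finset.mem_filter.1 hq
        refine Prod.ext (h.in_unique j hjK p.2 (hRX hp.2) _ _ (hSE p hp.1) ?_) hpq
        rw [hpq]; exact hSE q hq.1
      have h2 : (S.filter fun p => ¬ p.2 ∈ R).card ≤ (X \ R).card := by
        have key : ∀ p ∈ S.filter fun p => ¬ p.2 ∈ R, p.1 ∈ X \ R := by
          intro p hp
          have hp := Finset.mem_filter.1 hp
          have : p.1 ∉ insert o R := fun hc => hp.2 (hcon _ _ (hSE p hp.1) hc)
          simp only [Finset.mem_insert, not_or] at this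
          have hs := (h.supp j hjK _ _ (hSE p hp.1)).1
          simp only [Finset.mem_insert] at hs
          exact Finset.mem_sdiff.2 ⟨hs.resolve_left this.1, this.2⟩
        refine Finset.card_le_card_of_injOn Prod.fst key ?_
        intro p hp q hq hpq
        have hpX := (Finset.mem_sdiff.1 (key p hp)).1
        have hp := Finset.mem_filter.1 hp
        have hq := Finset.mem_filter.1 hq
        refine Prod.ext hpq (h.out_unique j hjK p.1 hpX _ _ (hSE p hp.1) ?_)
        rw [hpq]; exact hSE q hq.1
      have h3 := Finset.card_filter_add_card_filter_not (s := S) (fun p => p.2 ∈ R)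
      have h4 := Finset.card_sdiff_add_card_eq_card hRX
      omega
    have hwo : w ≠ o := by
      rintro rfl
      rcases Finset.mem_insert.1 hu with rfl | hu
      · exact h.no_direct j hjK he
      · obtain ⟨-, T', hT', hr⟩ := Finset.mem_filter.1 hu
        exact h.no_rainbow T' (hT'.trans hTK) u hr j hjK (fun hc => hj (hT' hc)) he
    have hwX : w ∈ X := (Finset.mem_insert.1 (h.supp j hjK _ _ he).2).resolve_left hwo
    rw [Finset.card_insert_of_notMem hj]
    calc T.card + 1 ≤ (insert w R).card := by rw [Finset.card_insert_of_notMem hw]; omega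
      _ ≤ _ := by
        refine Finset.card_le_card ?_
        intro x hx
        rcases Finset.mem_insert.1 hx with rfl | hx
        · refine Finset.mem_filter.2 ⟨hwX, ?_⟩
          rcases Finset.mem_insert.1 hu with rfl | hu
          · exact ⟨{j}, by simp, .single he hwo⟩
          · obtain ⟨-, T', hT', hr⟩ := Finset.mem_filter.1 hu
            exact ⟨insert j T', Finset.insert_subset_insert _ hT',
              hr.step (fun hc => hj (hT' hc)) he hwo⟩
        · obtain ⟨hxX, T', hT', hr⟩ := Finset.mem_filter.1 hx
          exact Finset.mem_filter.2 ⟨hxX, T', hT'.trans (Finset.subset_insert _ _), hr⟩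

theorem card_le (h : PathSystem E o X K) : K.card ≤ X.card := by
  classical
  exact (h.card_le_card_reach subset_rfl).trans (Finset.card_filter_le _ _)

/-- The last edge of the backward walk can be moved to the end of the forward walk, until one edge
into `o` remains. This makes the hypotheses symmetric under reversal of all edges. -/
theorem no_closed_walk (h : PathSystem E o X K) {T T' : Finset ι} {x : P}
    (hr' : RainbowReach (fun i u w => E i w u) o T' x) (hT' : T' ⊆ K) (hT : T ⊆ K)
    (hd : Disjoint T T') (hr : RainbowReach E o T x) : False := by
  induction hr' generalizing T with
  | @single i x he hx =>
    exact h.no_rainbow T hT x hr i (hT' (by simp)) (by simpa using hd) he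
  | @step T' i x y hr' hi he hy ih =>
    rw [Finset.disjoint_insert_right] at hd
    refine ih ((Finset.subset_insert _ _).trans hT')
      (Finset.insert_subset (hT' (Finset.mem_insert_self _ _)) hT) ?_ (hr.step hd.1 he hr'.ne)
    exact Finset.disjoint_insert_left.2 ⟨hi, hd.2⟩

theorem flip (h : PathSystem E o X K) : PathSystem (fun i u w => E i w u) o X K where
  notMem := h.notMem
  supp i hi u w he := (h.supp i hi w u he).symm
  out_unique i hi u hu w w' := h.in_unique i hi u hu w w'
  in_unique i hi u hu w w' := h.out_unique i hi u hu w w'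
  exists_edges i hi := by
    obtain ⟨S, hS, hSE⟩ := h.exists_edges i hi
    refine ⟨S.map (Equiv.prodComm P P).toEmbedding, by simpa using hS, ?_⟩
    simp only [Finset.mem_map_equiv]
    intro p hp
    exact hSE _ hp
  no_direct i hi := h.no_direct i hi
  no_rainbow T hT x hr i hi hiT he := by
    exact h.no_closed_walk hr hT (Finset.singleton_subset_iff.2 hi) (by simpa using hiT)
      (.single he hr.ne)

/-! ### Systems with as many colours as vertices -/

/-- The colours other than `i` already reach all but at most one vertex of `X`, and an edge of
colour `i` into `o` cannot start at a reached vertex. Thus every colour is a permutation of `insert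
o X`. -/
theorem target_unique (h : PathSystem E o X K) (hc : X.card = K.card) {i : ι} (hi : i ∈ K)
    {u u' : P} (he : E i u o) (he' : E i u' o) : u = u' := by
  classical
  have hcard := h.card_le_card_reach (Finset.erase_subset i K)
  set R := X.filter fun x => ∃ T' ⊆ K.erase i, RainbowReach E o T' x with hR
  have key : ∀ u, E i u o → u ∈ X \ R := by
    intro u he
    refine Finset.mem_sdiff.2 ⟨h.mem_of_edge_target hi he, fun hu => ?_⟩
    obtain ⟨-, T', hT', hr⟩ := Finset.mem_filter.1 hu
    exact h.no_rainbow T' (hT'.trans (Finset.erase_subset _ _)) u hr i hi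
      (fun hc => Finset.notMem_erase i K (hT' hc)) he
  have hRX : R ⊆ X := Finset.filter_subset _ _
  have h1 := Finset.card_sdiff_add_card_eq_card hRX
  rw [Finset.card_erase_of_mem hi] at hcard
  exact Finset.card_le_one.1 (by omega) _ (key u he) _ (key u' he')

theorem in_unique' (h : PathSystem E o X K) (hc : X.card = K.card) {i : ι} (hi : i ∈ K)
    {u u' w : P} (he : E i u w) (he' : E i u' w) : u = u' := by
  rcases Finset.mem_insert.1 (h.supp i hi _ _ he).2 with rfl | hw
  · exact h.target_unique hc hi he he'
  · exact h.in_unique i hi w hw _ _ he he'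

theorem out_unique' (h : PathSystem E o X K) (hc : X.card = K.card) {i : ι} (hi : i ∈ K)
    {u w w' : P} (he : E i u w) (he' : E i u w') : w = w' :=
  h.flip.in_unique' hc hi he he'

theorem exists_in (h : PathSystem E o X K) (hc : X.card = K.card) {i : ι} (hi : i ∈ K)
    {w : P} (hw : w ∈ insert o X) : ∃ u, E i u w := by
  obtain ⟨S, hS, hSE⟩ := h.exists_edges i hi
  have hinj : Set.InjOn Prod.snd (S : Set (P × P)) := by
    intro p hp q hq hpq
    refine Prod.ext (h.in_unique' hc hi (hSE p hp) ?_) hpq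
    rw [hpq]; exact hSE q hq
  have himg : S.image Prod.snd = insert o X := by
    refine Finset.eq_of_subset_of_card_le ?_ ?_
    · intro w hw
      obtain ⟨p, hp, rfl⟩ := Finset.mem_image.1 hw
      exact (h.supp i hi _ _ (hSE p hp)).2
    · rw [Finset.card_image_of_injOn hinj, Finset.card_insert_of_notMem h.notMem]
      exact hS
  rw [← himg] at hw
  obtain ⟨p, hp, rfl⟩ := Finset.mem_image.1 hw
  exact ⟨p.1, hSE p hp⟩

theorem exists_out (h : PathSystem E o X K) (hc : X.card = K.card) {i : ι} (hi : i ∈ K)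
    {u : P} (hu : u ∈ insert o X) : ∃ w, E i u w :=
  h.flip.exists_in hc hi hu

theorem contract (h : PathSystem E o X K) {j : ι} (hj : j ∈ K) {v : P} (hv : E j o v) :
    PathSystem (contractSource E o v) o (X.erase v) (K.erase j) := by
  have hvX := h.mem_of_edge_source hj hv
  have hvo : v ≠ o := fun e => h.notMem (e ▸ hvX)
  have hvt : ∀ i ∈ K.erase j, ¬ E i v o := fun i hi he =>
    h.no_rainbow {j} (by simpa using hj) v (.single hv hvo) i (Finset.mem_of_mem_erase hi)
      (by simpa using Finset.ne_of_mem_erase hi) he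
  refine ⟨fun ho => h.notMem (Finset.mem_of_mem_erase ho), ?_, ?_, ?_, ?_, ?_, ?_⟩
  · rintro i hi u w ⟨hu, hw, he⟩
    have hiK := Finset.mem_of_mem_erase hi
    have hoX := Finset.mem_insert_self o X
    have hm : u ∈ insert o X ∧ w ∈ insert o X := by
      rcases he with he | ⟨rfl, he⟩
      · exact h.supp i hiK _ _ he
      · exact ⟨hoX, (h.supp i hiK _ _ he).2⟩
    simp only [Finset.mem_insert, Finset.mem_erase] at hm ⊢
    tauto
  · rintro i hi u hu w w' ⟨-, -, he⟩ ⟨-, -, he'⟩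
    have huX := Finset.mem_of_mem_erase hu
    have huo : u ≠ o := fun e => h.notMem (e ▸ huX)
    exact h.out_unique i (Finset.mem_of_mem_erase hi) u huX _ _
      (he.resolve_right fun e => huo e.1) (he'.resolve_right fun e => huo e.1)
  · rintro i hi w hw u u' ⟨hu, -, he⟩ ⟨hu', -, he'⟩
    have hun := h.in_unique i (Finset.mem_of_mem_erase hi) w (Finset.mem_of_mem_erase hw)
    rcases he with he | ⟨rfl, he⟩ <;> rcases he' with he' | ⟨rfl, he'⟩
    · exact hun _ _ he he'
    · exact absurd (hun _ _ he he') hu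
    · exact absurd (hun _ _ he' he) hu'
    · rfl
  · intro i hi
    have hiK := Finset.mem_of_mem_erase hi
    obtain ⟨S, hS, hSE⟩ := h.exists_edges i hiK
    -- Only edges into `v` are lost, at most one per colour, while the vertex set also shrinks by
    -- one.
    have hS1 : (S.filter fun p => p.2 = v).card ≤ 1 := by
      refine Finset.card_le_one.2 fun p hp q hq => ?_
      obtain ⟨hp, hpv⟩ := Finset.mem_filter.1 hp
      obtain ⟨hq, hqv⟩ := Finset.mem_filter.1 hq
      exact Prod.ext (h.in_unique i hiK v hvX _ _ (hpv ▸ hSE p hp) (hqv ▸ hSE q hq))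
        (hpv.trans hqv.symm)
    have h3 := Finset.card_filter_add_card_filter_not (s := S) (fun p => p.2 = v)
    have h4 := Finset.card_erase_add_one hvX
    refine ⟨(S.filter fun p => ¬ p.2 = v).image fun p => (if p.1 = v then o else p.1, p.2), ?_, ?_⟩
    · rw [Finset.card_image_of_injOn]
      · omega
      intro p hp q hq hpq
      obtain ⟨hp, hpv⟩ := Finset.mem_filter.1 hp
      obtain ⟨hq, hqv⟩ := Finset.mem_filter.1 hq
      simp only [Prod.mk.injEq] at hpq
      obtain ⟨h1, h2⟩ := hpq
      have hEp := hSE p hp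
      have hEq := hSE q hq
      rw [← h2] at hEq
      rcases Finset.mem_insert.1 (h.supp i hiK _ _ hEp).2 with e | hp2
      · rw [e] at hEp hEq
        have hp1 : p.1 ≠ v := fun e' => hvt i hi (e' ▸ hEp)
        have hq1 : q.1 ≠ v := fun e' => hvt i hi (e' ▸ hEq)
        rw [if_neg hp1, if_neg hq1] at h1
        exact Prod.ext h1 h2
      · exact Prod.ext (h.in_unique i hiK _ hp2 _ _ hEp hEq) h2
    · intro p hp
      obtain ⟨q, hq, rfl⟩ := Finset.mem_image.1 hp
      obtain ⟨hq, hqv⟩ := Finset.mem_filter.1 hq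
      refine ⟨?_, hqv, ?_⟩
      · dsimp only
        split_ifs with hs
        · exact hvo.symm
        · exact hs
      · dsimp only
        split_ifs with hs
        · exact Or.inr ⟨rfl, hs ▸ hSE q hq⟩
        · exact Or.inl (hSE q hq)
  · rintro i hi ⟨-, -, he | ⟨-, he⟩⟩
    · exact h.no_direct i (Finset.mem_of_mem_erase hi) he
    · exact hvt i hi he
  · rintro T hT x hr i hi hiT ⟨hx, -, he⟩
    have hjT : j ∉ T := fun hc => Finset.notMem_erase j K (hT hc)
    have hTK := hT.trans (Finset.erase_subset _ _)
    replace he := he.resolve_right fun e => hr.ne e.1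
    rcases hr.of_contractSource hv hvo hjT with hr | hr
    · exact h.no_rainbow T hTK x hr i (Finset.mem_of_mem_erase hi) hiT he
    · refine h.no_rainbow _ (Finset.insert_subset hj hTK) x hr i (Finset.mem_of_mem_erase hi) ?_ he
      simpa [hiT] using Finset.ne_of_mem_erase hi

/-- Otherwise, after merging `v` into `o`, the successors of `o` and of `v` in colour `i` would both
follow the new source. They would have to agree, against injectivity of colour `i`. -/
theorem edge_or_loop (h : PathSystem E o X K) (hc : X.card = K.card) {i j : ι} (hi : i ∈ K)
    (hj : j ∈ K) (hij : i ≠ j) {v : P} (hv : E j o v) : E i o v ∨ E i v v := by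
  have hvX := h.mem_of_edge_source hj hv
  have hov : o ≠ v := fun e => h.notMem (e ▸ hvX)
  have hiK : i ∈ K.erase j := Finset.mem_erase.2 ⟨hij, hi⟩
  obtain ⟨w, hw⟩ := h.exists_out hc hi (Finset.mem_insert_self o X)
  obtain ⟨w', hw'⟩ := h.exists_out hc hi (Finset.mem_insert_of_mem hvX)
  by_contra! hcon
  have hwv : w ≠ v := fun e => hcon.1 (e ▸ hw)
  have hwv' : w' ≠ v := fun e => hcon.2 (e ▸ hw')
  have hc' : (X.erase v).card = (K.erase j).card := by
    rw [Finset.card_erase_of_mem hvX, Finset.card_erase_of_mem hj, hc]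
  have : w = w' := (h.contract hj hv).out_unique' hc' hiK
    ⟨hov, hwv, Or.inl hw⟩ ⟨hov, hwv', Or.inr ⟨rfl, hw'⟩⟩
  exact hov (h.in_unique' hc hi hw (this ▸ hw'))

end PathSystem

/-! ### The common Hamiltonian cycle -/

theorem List.IsChain.eq_of_functional {P : Type*} {R : P → P → Prop} {o : P} {a : P}
    {l m : List P} (hR : ∀ u w w', R u w → R u w' → w = w')
    (hl : List.IsChain R (a :: (l ++ [o]))) (hm : List.IsChain R (a :: (m ++ [o])))
    (hol : o ∉ l) (hom : o ∉ m) : l = m := by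
  induction l generalizing a m with
  | nil =>
    cases m with
    | nil => rfl
    | cons y m =>
      simp only [List.nil_append, List.cons_append, List.isChain_cons_cons] at hl hm
      exact absurd (hR _ _ _ hl.1 hm.1) (by rintro rfl; simp at hom)
  | cons x l ih =>
    cases m with
    | nil =>
      simp only [List.nil_append, List.cons_append, List.isChain_cons_cons] at hl hm
      exact absurd (hR _ _ _ hm.1 hl.1) (by rintro rfl; simp at hol)
    | cons y m =>
      simp only [List.cons_append, List.isChain_cons_cons] at hl hm
      obtain rfl := hR _ _ _ hl.1 hm.1
      rw [ih hl.2 hm.2 (fun hc => hol (List.mem_cons_of_mem _ hc))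
        (fun hc => hom (List.mem_cons_of_mem _ hc))]

theorem List.IsChain.of_contractSource {ι P : Type*} {E : ι → P → P → Prop} {o v : P} {i : ι}
    {l : List P} (h : List.IsChain (contractSource E o v i) (l ++ [o])) (ho : o ∉ l) :
    List.IsChain (E i) (l ++ [o]) := by
  induction l with
  | nil => simp
  | cons x l ih =>
    simp only [List.mem_cons, not_or] at ho
    have ih := ih (List.IsChain.of_cons h) ho.2
    cases l with
    | nil =>
      simp only [List.cons_append, List.nil_append, List.isChain_cons_cons] at h ⊢
      exact ⟨h.1.2.2.resolve_right fun e => ho.1 e.1.symm, by simp⟩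
    | cons y l =>
      simp only [List.cons_append, List.isChain_cons_cons] at h ih ⊢
      exact ⟨h.1.2.2.resolve_right fun e => ho.1 e.1.symm, ih⟩

namespace PathSystem

variable {ι P : Type*} [DecidableEq ι] [DecidableEq P] {E : ι → P → P → Prop} {o : P}
  {X : Finset P} {K : Finset ι}

/-- Induction step: every contraction along an edge from `o` to a vertex other than `f` has a common
cycle. Once all colours are known to share the edge from `o` to `v`, inserting `v` after `o` lifts
the cycle. -/
theorem exists_list_of_contract (h : PathSystem E o X K) (hc : X.card = K.card) {f : P}
    (hfX : f ∈ X) (hf : ∀ i ∈ K, ¬ E i f f) {j : ι} (hj : j ∈ K) {v : P} (hv : E j o v)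
    (hvf : v ≠ f)
    (ih : ∀ i ∈ K, ∀ w ≠ f, E i o w → ∃ l : List P, l.Nodup ∧ (∀ x, x ∈ l ↔ x ∈ X.erase w) ∧
      ∀ m ∈ K.erase i, List.IsChain (contractSource E o w m) (o :: (l ++ [o]))) :
    ∃ l : List P, l.Nodup ∧ (∀ x, x ∈ l ↔ x ∈ X) ∧
      ∀ i ∈ K, List.IsChain (E i) (o :: (l ++ [o])) := by
  have hfun : ∀ i ∈ K, ∀ u w w', E i u w → E i u w' → w = w' :=
    fun i hi u w w' => h.out_unique' hc hi
  have hcofun : ∀ i ∈ K, ∀ u u' w, E i u w → E i u' w → u = u' :=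
    fun i hi u w w' => h.in_unique' hc hi
  have hnil : ∀ (w : P) (l : List P), w ≠ f → (∀ x, x ∈ l ↔ x ∈ X.erase w) →
      o ∉ l ∧ ∃ x l', l = x :: l' := by
    intro w l hw hl
    refine ⟨fun ho => h.notMem (Finset.mem_of_mem_erase ((hl o).1 ho)), ?_⟩
    have : f ∈ l := (hl f).2 (Finset.mem_erase.2 ⟨hw.symm, hfX⟩)
    cases l with
    | nil => simp at this
    | cons x l' => exact ⟨x, l', rfl⟩
  have hvX := h.mem_of_edge_source hj hv
  obtain ⟨l, hnd, hl, hch⟩ := ih j hj v hvf hv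
  obtain ⟨hol, x, l', rfl⟩ := hnil v l hvf hl
  have hxX : x ∈ X.erase v := (hl x).1 (by simp)
  have hxo : x ≠ o := fun e => hol (by simp [e])
  have hx1 : ∀ m ∈ K.erase j, E m o x ∨ E m v x := by
    intro m hm
    have := hch m hm
    simp only [List.cons_append, List.isChain_cons_cons] at this
    exact this.1.2.2.imp_right And.right
  -- every colour has the edge from `o` to `v`
  have hall : ∀ i ∈ K, E i o v := by
    intro i hi
    by_contra hiv
    have hij : i ≠ j := by rintro rfl; exact hiv hv
    have hvv := (h.edge_or_loop hc hi hj hij hv).resolve_left hiv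
    have hix : E i o x := (hx1 i (Finset.mem_erase.2 ⟨hij, hi⟩)).resolve_right fun e =>
      Finset.ne_of_mem_erase hxX (hfun i hi _ _ _ e hvv)
    have hjx : E j x x := (h.edge_or_loop hc hj hi hij.symm hix).resolve_left fun e =>
      Finset.ne_of_mem_erase hxX (hfun j hj _ _ _ e hv)
    -- Now `i` and `j` play symmetric roles: `i` goes from `o` to `x` and loops at `v`, `j` goes
    -- from `o` to `v` and loops at `x`. A third colour is trapped between the two contractions.
    have hxf : x ≠ f := by rintro rfl; exact hf j hj hjx
    obtain ⟨m', -, hm', hch'⟩ := ih i hi x hxf hix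
    obtain ⟨hom', y, m'', rfl⟩ := hnil x m' hxf hm'
    have hy : ∀ m ∈ K.erase i, E m o y ∨ E m x y := by
      intro m hm
      have := hch' m hm
      simp only [List.cons_append, List.isChain_cons_cons] at this
      exact this.1.2.2.imp_right And.right
    have hjy : y = v := by
      rcases hy j (Finset.mem_erase.2 ⟨hij.symm, hj⟩) with e | e
      · exact hfun j hj _ _ _ e hv
      · have := hfun j hj _ _ _ e hjx
        have hyX := (hm' y).1 (by simp)
        exact absurd this (Finset.ne_of_mem_erase hyX)
    subst hjy
    have h3 : 2 < X.card := Finset.two_lt_card.2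
      ⟨y, hvX, x, Finset.mem_of_mem_erase hxX, f, hfX, (Finset.ne_of_mem_erase hxX).symm, hvf, hxf⟩
    obtain ⟨m, hm, hmi, hmj⟩ : ∃ m ∈ K, m ≠ i ∧ m ≠ j := by
      by_contra! hcon
      have : K ⊆ {i, j} := by
        intro m hm
        by_cases hmi : m = i
        · simp [hmi]
        · simp [hcon m hm hmi]
      have := Finset.card_le_card this
      have := Finset.card_le_two (a := i) (b := j)
      omega
    have hmx : E m o x := by
      refine (h.edge_or_loop hc hm hi hmi hix).resolve_right fun e => ?_
      rcases hx1 m (Finset.mem_erase.2 ⟨hmj, hm⟩) with e' | e'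
      · exact hxo (hcofun m hm _ _ _ e e')
      · exact Finset.ne_of_mem_erase hxX (hcofun m hm _ _ _ e e')
    have hmxy : E m x y := (hy m (Finset.mem_erase.2 ⟨hmi, hm⟩)).resolve_left fun e =>
      Finset.ne_of_mem_erase hxX (hfun m hm _ _ _ hmx e)
    have := hch m (Finset.mem_erase.2 ⟨hmj, hm⟩)
    cases l' with
    | nil =>
      simp only [List.cons_append, List.nil_append, List.isChain_cons_cons] at this
      have hz := this.2.1
      exact hz.2.1 (hfun m hm _ _ _ (hz.2.2.resolve_right fun e => hxo e.1) hmxy)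
    | cons z l' =>
      simp only [List.cons_append, List.isChain_cons_cons] at this
      have hz := this.2.1
      exact hz.2.1 (hfun m hm _ _ _ (hz.2.2.resolve_right fun e => hxo e.1) hmxy)
  have hov : o ≠ v := fun e => h.notMem (e ▸ hvX)
  have lift : ∀ (m : List P), (∀ x, x ∈ m ↔ x ∈ X.erase v) → ∀ i ∈ K,
      List.IsChain (contractSource E o v i) (o :: (m ++ [o])) →
      List.IsChain (E i) (o :: (v :: m ++ [o])) := by
    intro m hm i hi hcm
    obtain ⟨hom, y, m', rfl⟩ := hnil v m hvf hm
    have h1 := (List.IsChain.of_cons hcm).of_contractSource hom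
    simp only [List.cons_append, List.isChain_cons_cons] at hcm h1 ⊢
    refine ⟨hall i hi, ?_, h1⟩
    rcases hcm.1.2.2 with e | e
    · exact absurd (hfun i hi _ _ _ e (hall i hi)) hcm.1.2.1
    · exact e.2
  refine ⟨v :: x :: l', List.nodup_cons.2 ⟨fun e => Finset.notMem_erase v X ((hl v).1 e), hnd⟩,
    ?_, ?_⟩
  · intro y
    rw [List.mem_cons, hl, Finset.mem_erase]
    by_cases hy : y = v
    · simp [hy, hvX]
    · simp [hy]
  · intro i hi
    by_cases hij : i = j
    swap
    · exact lift _ hl i hi (hch i (Finset.mem_erase.2 ⟨hij, hi⟩))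
    subst hij
    -- Contracting along `j` says nothing about colour `j` itself, so a contraction along another
    -- colour `i'` is used and its cycle is compared with the first.
    have h2 : 1 < K.card := by
      rw [← hc]
      exact Finset.one_lt_card.2 ⟨v, hvX, f, hfX, hvf⟩
    obtain ⟨i', hi', hne⟩ := Finset.exists_mem_ne h2 i
    obtain ⟨m, hmnd, hm, hchm⟩ := ih i' hi' v hvf (hall i' hi')
    have := lift m hm i hi (hchm i (Finset.mem_erase.2 ⟨hne.symm, hi⟩))
    suffices hml : m = x :: l' by rwa [hml] at this
    by_cases h3 : ∃ i'' ∈ K, i'' ≠ i ∧ i'' ≠ i'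
    · obtain ⟨p, hp, hpi, hpi'⟩ := h3
      have h1 := lift m hm p hp (hchm p (Finset.mem_erase.2 ⟨hpi', hp⟩))
      have h2 := lift _ hl p hp (hch p (Finset.mem_erase.2 ⟨hpi, hp⟩))
      exact List.IsChain.eq_of_functional (hfun p hp) (List.IsChain.of_cons h1)
        (List.IsChain.of_cons h2) (hnil v m hvf hm).1 hol
    -- With only two colours at most one vertex is left besides `v`, so the order is forced.
    · push Not at h3
      have hK : K ⊆ {i, i'} := by
        intro p hp
        by_cases hpi : p = i
        · simp [hpi]
        · simp [h3 p hp hpi]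
      have hK2 := (Finset.card_le_card hK).trans Finset.card_le_two
      have h1 : (X.erase v).card ≤ 1 := by
        rw [Finset.card_erase_of_mem hvX]; omega
      have hperm : m.Perm (x :: l') := (List.perm_ext_iff_of_nodup hmnd hnd).2 fun a => by
        rw [hm, hl]
      have hlen : (x :: l').length ≤ 1 := by
        rw [← List.toFinset_card_of_nodup hnd]
        refine le_trans (Finset.card_le_card fun a ha => ?_) h1
        rw [List.mem_toFinset, hl] at ha
        exact ha
      have : l' = [] := by
        cases l' with
        | nil => rfl
        | cons => simp at hlen
      subst this
      exact List.perm_singleton.1 hperm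

/-- Contraction must keep the loopless vertex `f`, so an edge between `o` and another vertex is
needed, in either direction. If the chosen colour only goes from `o` to `f` and back, any second
colour also goes from `o` to `f` and closes a rainbow walk; hence there is just one colour. -/
theorem exists_list (h : PathSystem E o X K) (hc : X.card = K.card) {f : P}
    (hfX : f ∈ X) (hf : ∀ i ∈ K, ¬ E i f f) :
    ∃ l : List P, l.Nodup ∧ (∀ x, x ∈ l ↔ x ∈ X) ∧
      ∀ i ∈ K, List.IsChain (E i) (o :: (l ++ [o])) := by
  induction hk : X.card generalizing E X K with
  | zero => simp [Finset.card_eq_zero.1 hk] at hfX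
  | succ k ih =>
    have key : ∀ (E : ι → P → P → Prop), PathSystem E o X K → (∀ i ∈ K, ¬ E i f f) →
        ∀ j ∈ K, ∀ v ≠ f, E j o v → ∃ l : List P, l.Nodup ∧ (∀ x, x ∈ l ↔ x ∈ X) ∧
          ∀ i ∈ K, List.IsChain (E i) (o :: (l ++ [o])) := by
      intro E h hf j hj v hvf hv
      refine h.exists_list_of_contract hc hfX hf hj hv hvf ?_
      intro i hi w hwf hw
      have hwX := h.mem_of_edge_source hi hw
      have hfo : f ≠ o := fun e => h.notMem (e ▸ hfX)
      refine ih (h.contract hi hw) ?_ (Finset.mem_erase.2 ⟨hwf.symm, hfX⟩) ?_ ?_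
      · rw [Finset.card_erase_of_mem hwX, Finset.card_erase_of_mem hi, hc]
      · rintro m hm ⟨-, -, e | e⟩
        · exact hf m (Finset.mem_of_mem_erase hm) e
        · exact hfo e.1
      · rw [Finset.card_erase_of_mem hwX, hk]; rfl
    obtain ⟨j, hj⟩ : K.Nonempty := Finset.card_pos.1 (by omega)
    obtain ⟨v, hv⟩ := h.exists_out hc hj (Finset.mem_insert_self o X)
    by_cases hvf : v ≠ f
    · exact key E h hf j hj v hvf hv
    obtain ⟨v', hv'⟩ := h.exists_in hc hj (Finset.mem_insert_self o X)
    by_cases hvf' : v' ≠ f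
    · obtain ⟨l, hnd, hl, hch⟩ := key _ h.flip hf j hj v' hvf' hv'
      refine ⟨l.reverse, List.nodup_reverse.2 hnd, by simpa using hl, fun i hi => ?_⟩
      have := List.isChain_reverse.2 (hch i hi)
      simpa using this
    push Not at hvf hvf'
    rw [hvf] at hv
    rw [hvf'] at hv'
    have hone : ∀ i ∈ K, i = j := by
      intro i hi
      by_contra hij
      have h1 := (h.edge_or_loop hc hi hj hij hv).resolve_right (hf i hi)
      refine h.no_rainbow {i} (by simpa using hi) _ (.single h1 ?_) j hj
        (by simpa using Ne.symm hij) hv'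
      rintro rfl
      exact h.notMem hfX
    have hX : ∀ x ∈ X, x = f := by
      have : K ⊆ {j} := fun i hi => by simp [hone i hi]
      have := Finset.card_le_card this
      rw [Finset.card_singleton] at this
      exact fun x hx => Finset.card_le_one.1 (by omega) x hx f hfX
    refine ⟨[f], by simp, fun x => ⟨?_, ?_⟩, fun i hi => ?_⟩
    · simp only [List.mem_singleton]
      rintro rfl
      exact hfX
    · simpa using hX x
    · rw [hone i hi]
      simp [hv, hv']

end PathSystem

/-! ### Rainbow matchings and their contraction -/

/-- A family `N` of bipartite matchings, given as relations, each with exactly `s` edges. -/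
structure MatchingFamily {ι A B : Type*} (N : ι → A → B → Prop) (s : ℕ) : Prop where
  right_unique : ∀ i a b b', N i a b → N i a b' → b = b'
  left_unique : ∀ i a a' b, N i a b → N i a' b → a = a'
  exists_edges : ∀ i, ∃ S : Finset (A × B), S.card = s ∧ ∀ p, p ∈ S ↔ N i p.1 p.2

/-- A rainbow matching of the family `N` whose edges are indexed by `J`: the edge at `x` joins
`left x` to `right x` and has colour `color x`. -/
structure RainbowMatching {ι A B : Type*} (N : ι → A → B → Prop) (J : Type*) where
  left : J → A
  right : J → B
  color : J → ι
  left_inj : Function.Injective left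
  right_inj : Function.Injective right
  color_inj : Function.Injective color
  edge : ∀ x, N (color x) (left x) (right x)

theorem MatchingFamily.swap {ι A B : Type*} {N : ι → A → B → Prop} {s : ℕ}
    (h : MatchingFamily N s) : MatchingFamily (fun i b a => N i a b) s where
  right_unique i b a a' := h.left_unique i a a' b
  left_unique i b b' a := h.right_unique i a b b'
  exists_edges i := by
    obtain ⟨S, hS, hSN⟩ := h.exists_edges i
    refine ⟨S.map (Equiv.prodComm A B).toEmbedding, by simpa using hS, fun p => ?_⟩
    rw [Finset.mem_map_equiv]
    exact hSN _

/-- The value `some x` classifies the vertex `f x`, and `none` classifies the vertices outside the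
range of `f`. -/
def Classifies {J A : Type*} (f : J → A) : Option J → A → Prop
  | none, a => a ∉ Set.range f
  | some x, a => a = f x

theorem exists_classifies {J A : Type*} (f : J → A) (a : A) : ∃ u, Classifies f u a := by
  by_cases h : a ∈ Set.range f
  · obtain ⟨x, rfl⟩ := h
    exact ⟨some x, rfl⟩
  · exact ⟨none, h⟩

theorem Classifies.unique {J A : Type*} {f : J → A} (hf : Function.Injective f) {u u' : Option J}
    {a : A} (h : Classifies f u a) (h' : Classifies f u' a) : u = u' := by
  cases u <;> cases u' <;> simp only [Classifies] at h h'
  · rfl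
  · exact absurd ⟨_, h'.symm⟩ h
  · exact absurd ⟨_, h.symm⟩ h'
  · rw [hf (h.symm.trans h')]

namespace RainbowMatching

variable {ι A B J : Type*} {N : ι → A → B → Prop}

/-- Exchange the two sides. -/
def swap (F : RainbowMatching N J) : RainbowMatching (fun i b a => N i a b) J where
  left := F.right
  right := F.left
  color := F.color
  left_inj := F.right_inj
  right_inj := F.left_inj
  color_inj := F.color_inj
  edge := F.edge

/-- Reindex a rainbow matching. -/
def reindex {J' : Type*} (F : RainbowMatching N J) (e : J' → J) (he : Function.Injective e) :
    RainbowMatching N J' where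
  left := F.left ∘ e
  right := F.right ∘ e
  color := F.color ∘ e
  left_inj := F.left_inj.comp he
  right_inj := F.right_inj.comp he
  color_inj := F.color_inj.comp he
  edge x := F.edge (e x)

/-- Add an edge. -/
def extend (F : RainbowMatching N J) {i : ι} {a : A} {b : B} (hi : i ∉ Set.range F.color)
    (ha : a ∉ Set.range F.left) (hb : b ∉ Set.range F.right) (h : N i a b) :
    RainbowMatching N (Option J) where
  left u := u.elim a F.left
  right u := u.elim b F.right
  color u := u.elim i F.color
  left_inj := Option.injective_iff.2 ⟨F.left_inj, ha⟩
  right_inj := Option.injective_iff.2 ⟨F.right_inj, hb⟩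
  color_inj := Option.injective_iff.2 ⟨F.color_inj, hi⟩
  edge u := by cases u; exacts [h, F.edge _]

theorem update_injective [DecidableEq J] {β : Type*} {f : J → β} (hf : Function.Injective f) {y : J}
    {a : β} (ha : ∀ x ≠ y, f x ≠ a) : Function.Injective (Function.update f y a) := by
  intro x x' h
  by_cases hx : x = y <;> by_cases hx' : x' = y
  · rw [hx, hx']
  · subst hx
    rw [Function.update_self, Function.update_of_ne hx'] at h
    exact absurd h.symm (ha _ hx')
  · subst hx'
    rw [Function.update_self, Function.update_of_ne hx] at h
    exact absurd h (ha _ hx)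
  · rw [Function.update_of_ne hx, Function.update_of_ne hx'] at h
    exact hf h

/-- Replace the edge at `y` by an edge with the same right end and another colour. -/
def replace [DecidableEq J] (F : RainbowMatching N J) (y : J) {i : ι} {a : A}
    (hi : ∀ x ≠ y, F.color x ≠ i) (ha : ∀ x ≠ y, F.left x ≠ a) (h : N i a (F.right y)) :
    RainbowMatching N J where
  left := Function.update F.left y a
  right := F.right
  color := Function.update F.color y i
  left_inj := update_injective F.left_inj ha
  right_inj := F.right_inj
  color_inj := update_injective F.color_inj hi
  edge x := by
    by_cases hx : x = y
    · subst hx; simpa using h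
    · simpa [hx] using F.edge x

/-- The relation on `Option J` induced by the matching of colour `i` when the edges of `F` are
contracted, `none` standing for the vertices not covered by `F`. -/
def rel (F : RainbowMatching N J) (i : ι) (u w : Option J) : Prop :=
  ∃ a b, Classifies F.left u a ∧ Classifies F.right w b ∧ N i a b

/-- Alternating exchange along the walk, with `R` the set of visited edges of `F`: any visited left
end can be freed while the right ends stay covered. Stating this for all of `R` copes with walks
that revisit a vertex. -/
theorem exists_of_reach [DecidableEq ι] [DecidableEq J] (F : RainbowMatching N J) {T : Finset ι}
    {u : Option J} (h : RainbowReach F.rel none T u) (hT : ∀ i ∈ T, i ∉ Set.range F.color) :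
    ∃ R : Set J, (∃ x ∈ R, u = some x) ∧ ∀ r ∈ R, ∃ F' : RainbowMatching N J,
      F'.right = F.right ∧ (∀ x ∉ R, F'.left x = F.left x) ∧ F.left r ∉ Set.range F'.left ∧
      ∀ x, F'.color x ∈ Set.range F.color ∨ F'.color x ∈ T := by
  induction h with
  | @single i u he hu =>
    obtain ⟨x, rfl⟩ := Option.ne_none_iff_exists'.1 hu
    obtain ⟨a, b, ha, rfl, hN⟩ := he
    refine ⟨{x}, ⟨x, rfl, rfl⟩, ?_⟩
    rintro r rfl
    refine ⟨F.replace r (fun y _ hy => hT i (by simp) ⟨y, hy⟩) (fun y _ hy => ha ⟨y, hy⟩) hN,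
      rfl, fun y hy => Function.update_of_ne hy _ _, ?_, fun y => ?_⟩
    · rintro ⟨y, hy⟩
      by_cases hyr : y = r
      · subst hyr
        simp only [replace, Function.update_self] at hy
        exact ha ⟨y, hy.symm⟩
      · simp only [replace, Function.update_of_ne hyr] at hy
        exact hyr (F.left_inj hy)
    · by_cases hyr : y = r
      · subst hyr; simp [replace]
      · simp [replace, hyr]
  | @step T i u w hr hi he hw ih =>
    obtain ⟨R, ⟨x, hxR, rfl⟩, hR⟩ := ih fun i hi => hT i (Finset.mem_insert_of_mem hi)
    obtain ⟨y, rfl⟩ := Option.ne_none_iff_exists'.1 hw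
    obtain ⟨a, b, rfl, rfl, hN⟩ := he
    have hmono : ∀ r ∈ R, ∃ F' : RainbowMatching N J,
        F'.right = F.right ∧ (∀ x ∉ R, F'.left x = F.left x) ∧ F.left r ∉ Set.range F'.left ∧
        ∀ x, F'.color x ∈ Set.range F.color ∨ F'.color x ∈ insert i T := by
      intro r hr
      obtain ⟨F', h1, h2, h3, h4⟩ := hR r hr
      exact ⟨F', h1, h2, h3, fun x => (h4 x).imp_right fun h => Finset.mem_insert_of_mem h⟩
    by_cases hyR : y ∈ R
    · exact ⟨R, ⟨y, hyR, rfl⟩, hmono⟩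
    refine ⟨insert y R, ⟨y, Set.mem_insert _ _, rfl⟩, ?_⟩
    intro r hrR
    rcases hrR with rfl | hrR
    swap
    · obtain ⟨F', h1, h2, h3⟩ := hmono r hrR
      exact ⟨F', h1, fun x hx => h2 x fun hc => hx (Set.mem_insert_of_mem _ hc), h3⟩
    obtain ⟨F', h1, h2, h3, h4⟩ := hR x hxR
    have hri : ∀ z, F'.color z ≠ i := by
      intro z hz
      rcases h4 z with h | h
      · exact hT i (Finset.mem_insert_self _ _) (hz ▸ h)
      · exact hi (hz ▸ h)
    have hxr : x ≠ r := fun e => hyR (e ▸ hxR)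
    refine ⟨F'.replace r (i := i) (a := F.left x) (fun z _ => hri z) (fun z _ hz => h3 ⟨z, hz⟩)
      (h1 ▸ hN), h1, fun z hz => ?_, ?_, fun z => ?_⟩
    · simp only [Set.mem_insert_iff, not_or] at hz
      exact (Function.update_of_ne hz.1 _ _).trans (h2 z hz.2)
    · rintro ⟨z, hz⟩
      by_cases hzr : z = r
      · subst hzr
        simp only [replace, Function.update_self] at hz
        exact hxr (F.left_inj hz)
      · simp only [replace, Function.update_of_ne hzr] at hz
        exact hzr (F'.left_inj (hz.trans (h2 r hyR).symm))
    · by_cases hzr : z = r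
      · subst hzr; simp [replace]
      · simpa [replace, hzr] using (h4 z).imp_right Or.inr

section

variable [Fintype ι] [Fintype J] [DecidableEq ι]

/-- The colours not used by `F`. -/
def unused (F : RainbowMatching N J) : Finset ι := Finset.univ.filter fun i => ∀ x, F.color x ≠ i

@[simp] theorem mem_unused (F : RainbowMatching N J) {i : ι} : i ∈ F.unused ↔ ∀ x, F.color x ≠ i := by
  simp [unused]

theorem card_unused (F : RainbowMatching N J) :
    F.unused.card + Fintype.card J = Fintype.card ι := by
  have : F.unused = (Finset.univ.image F.color)ᶜ := by ext i; simp
  rw [this, Finset.card_compl, Finset.card_image_of_injective _ F.color_inj, Finset.card_univ]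
  exact Nat.sub_add_cancel (Fintype.card_le_of_injective _ F.color_inj)

theorem pathSystem [DecidableEq J] (F : RainbowMatching N J) {s : ℕ} (hN : MatchingFamily N s)
    (hs : Fintype.card J + 1 ≤ s) (hno : IsEmpty (RainbowMatching N (Option J))) :
    PathSystem F.rel none (Finset.univ.erase none) F.unused := by
  have hdir : ∀ i ∈ F.unused, ¬ F.rel i none none := by
    rintro i hi ⟨a, b, ha, hb, h⟩
    exact hno.elim (F.extend (i := i) (by simpa using hi) ha hb h)
  refine ⟨by simp, fun i _ u w _ => by simp [Finset.insert_erase], ?_, ?_, ?_, hdir, ?_⟩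
  · rintro i hi u hu w w' ⟨a, b, ha, hb, h⟩ ⟨a', b', ha', hb', h'⟩
    obtain ⟨x, rfl⟩ := Option.ne_none_iff_exists'.1 (Finset.ne_of_mem_erase hu)
    obtain rfl : a = a' := ha.trans ha'.symm
    obtain rfl := hN.right_unique i _ _ _ h h'
    exact hb.unique F.right_inj hb'
  · rintro i hi w hw u u' ⟨a, b, ha, hb, h⟩ ⟨a', b', ha', hb', h'⟩
    obtain ⟨x, rfl⟩ := Option.ne_none_iff_exists'.1 (Finset.ne_of_mem_erase hw)
    obtain rfl : b = b' := hb.trans hb'.symm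
    obtain rfl := hN.left_unique i _ _ _ h h'
    exact ha.unique F.left_inj ha'
  · intro i hi
    obtain ⟨S, hS, hSN⟩ := hN.exists_edges i
    choose f hf using exists_classifies F.left
    choose g hg using exists_classifies F.right
    refine ⟨S.image fun p => (f p.1, g p.2), ?_, ?_⟩
    · rw [Finset.card_image_of_injOn, hS, Finset.card_erase_of_mem (Finset.mem_univ _),
        Finset.card_univ, Fintype.card_option]
      · exact hs
      intro p hp q hq hpq
      simp only [Prod.mk.injEq] at hpq
      have hNp := (hSN p).1 hp
      have hNq := (hSN q).1 hq
      have h1 := hf p.1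
      have h1' := hf q.1
      have h2 := hg p.2
      have h2' := hg q.2
      rw [← hpq.1] at h1'
      rw [← hpq.2] at h2'
      -- Only the uncovered class forgets the vertex. No edge has both ends there, so one end is
      -- known and the matching determines the other.
      cases hu : f p.1 with
      | some x =>
        rw [hu] at h1 h1'
        have h : p.1 = q.1 := h1.trans h1'.symm
        rw [← h] at hNq
        exact Prod.ext h (hN.right_unique i _ _ _ hNp hNq)
      | none =>
        cases hw : g p.2 with
        | some y =>
          rw [hw] at h2 h2'
          have h : p.2 = q.2 := h2.trans h2'.symm
          rw [← h] at hNq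
          exact Prod.ext (hN.left_unique i _ _ _ hNp hNq) h
        | none => exact absurd ⟨_, _, hu ▸ h1, hw ▸ h2, hNp⟩ (hdir i hi)
    · intro p hp
      obtain ⟨q, hq, rfl⟩ := Finset.mem_image.1 hp
      exact ⟨q.1, q.2, hf _, hg _, (hSN q).1 hq⟩
  · rintro T hT u hr i hi hiT ⟨a, b, ha, hb, h⟩
    obtain ⟨R, ⟨x, hx, rfl⟩, hR⟩ := F.exists_of_reach hr fun j hj => by simpa using hT hj
    obtain ⟨F', h1, -, h3, h4⟩ := hR x hx
    refine hno.elim (F'.extend (i := i) ?_ (ha ▸ h3) (b := b) (h1 ▸ hb) h)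
    rintro ⟨z, rfl⟩
    rcases h4 z with ⟨w, hw⟩ | h
    · exact (F.mem_unused.1 hi) w hw
    · exact hiT h

end

end RainbowMatching

/-- A rainbow matching of size m < k leaves 2k - m > m colours unused, more than
`PathSystem.card_le` permits if it could not be enlarged. -/
theorem MatchingFamily.exists_rainbowMatching {ι A B : Type*} [Fintype ι] {N : ι → A → B → Prop}
    {k : ℕ} (hN : MatchingFamily N (k + 1)) (hι : Fintype.card ι = 2 * k) {m : ℕ} (hm : m ≤ k) :
    Nonempty (RainbowMatching N (Fin m)) := by
  classical
  induction m with
  | zero =>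
    exact ⟨⟨Fin.elim0, Fin.elim0, Fin.elim0, fun x => x.elim0, fun x => x.elim0, fun x => x.elim0,
      fun x => x.elim0⟩⟩
  | succ m ih =>
    obtain ⟨F⟩ := ih (by omega)
    by_contra hno
    have hno' : IsEmpty (RainbowMatching N (Option (Fin m))) :=
      ⟨fun F' => hno ⟨F'.reindex (finSuccEquiv m) (finSuccEquiv m).injective⟩⟩
    have h1 := (F.pathSystem hN (by simp; omega) hno').card_le
    have h2 := F.card_unused
    rw [Finset.card_erase_of_mem (Finset.mem_univ _), Finset.card_univ, Fintype.card_option] at h1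
    simp only [Fintype.card_fin] at h1 h2
    omega

/-! ### Extremal families and tight rainbow matchings -/

/-- A family of `2 * k` bipartite matchings of size `k + 1` without a rainbow matching of size
`k + 1`. -/
structure ExtremalFamily {ι A B : Type*} [Fintype ι] (N : ι → A → B → Prop) (k : ℕ) : Prop where
  matching : MatchingFamily N (k + 1)
  card_eq : Fintype.card ι = 2 * k
  no_rainbow : IsEmpty (RainbowMatching N (Option (Fin k)))

theorem ExtremalFamily.swap {ι A B : Type*} [Fintype ι] {N : ι → A → B → Prop}
    {k : ℕ} (h : ExtremalFamily N k) :
    ExtremalFamily (fun i b a => N i a b) k :=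
  ⟨h.matching.swap, h.card_eq, ⟨fun F => h.no_rainbow.elim F.swap⟩⟩

theorem List.exists_rel_of_isChain {P : Type*} {R R' : P → P → Prop} {a o : P} {l : List P} {u : P}
    (hu : u ∈ a :: l) (h : List.IsChain R (a :: (l ++ [o])))
    (h' : List.IsChain R' (a :: (l ++ [o]))) : ∃ w, R u w ∧ R' u w := by
  induction l generalizing a with
  | nil =>
    simp only [List.mem_singleton] at hu
    subst hu
    simp only [List.nil_append, List.isChain_cons_cons] at h h'
    exact ⟨o, h.1, h'.1⟩
  | cons x l ih =>
    simp only [List.cons_append, List.isChain_cons_cons] at h h'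
    rcases List.mem_cons.1 hu with rfl | hu
    · exact ⟨x, h.1, h'.1⟩
    · exact ih hu h.2 h'.2

namespace RainbowMatching

variable {ι A B J : Type*} [Fintype ι] [DecidableEq ι] {N : ι → A → B → Prop} {k : ℕ}

/-- Some edge of `F` belongs to no matching with unused colour. -/
def IsTight [Fintype J] (F : RainbowMatching N J) : Prop :=
  ∃ x, ∀ i ∈ F.unused, ¬ N i (F.left x) (F.right x)

theorem IsTight.swap [Fintype J] {F : RainbowMatching N J} (h : F.IsTight) : F.swap.IsTight := h

section

variable (h : ExtremalFamily N k) (F : RainbowMatching N (Fin k))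
include h

theorem pathSystem' : PathSystem F.rel none (Finset.univ.erase none) F.unused :=
  F.pathSystem h.matching (by simp) h.no_rainbow

theorem card_unused' : F.unused.card = k := by
  have := F.card_unused
  rw [h.card_eq, Fintype.card_fin] at this
  omega

theorem card_erase_eq :
    ((Finset.univ : Finset (Option (Fin k))).erase none).card = F.unused.card := by
  rw [F.card_unused' h, Finset.card_erase_of_mem (Finset.mem_univ _)]
  simp

theorem exists_left {i : ι} (hi : i ∈ F.unused) (y : Fin k) : ∃ a, N i a (F.right y) := by
  obtain ⟨u, a, b, -, rfl, hN⟩ := (F.pathSystem' h).exists_in (F.card_erase_eq h) hi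
    (w := some y) (by simp)
  exact ⟨a, hN⟩

theorem exists_right {i : ι} (hi : i ∈ F.unused) (y : Fin k) : ∃ b, N i (F.left y) b :=
  F.swap.exists_left h.swap hi y

theorem exists_source {i : ι} (hi : i ∈ F.unused) :
    ∃ a y, a ∉ Set.range F.left ∧ N i a (F.right y) := by
  obtain ⟨w, hw⟩ := (F.pathSystem' h).exists_out (F.card_erase_eq h) hi (u := none) (by simp)
  cases w with
  | none => exact absurd hw ((F.pathSystem' h).no_direct i hi)
  | some y =>
    obtain ⟨a, b, ha, rfl, hN⟩ := hw
    exact ⟨a, y, ha, hN⟩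

-- The edge of colour `i` from an uncovered vertex to `F.right y` replaces the edge at `y`, which
-- was not in matching `i`; no edge of matching `i` is lost.
open Classical in
theorem exists_more_edges {i : ι} (hi : i ∈ F.unused) :
    ∃ F' : RainbowMatching N (Fin k), i ∈ Set.range F'.color ∧
      (Finset.univ.filter fun x => N i (F.left x) (F.right x)).card <
        (Finset.univ.filter fun x => N i (F'.left x) (F'.right x)).card := by
  obtain ⟨a, y, ha, hN⟩ := F.exists_source h hi
  refine ⟨F.replace y (fun x _ => F.mem_unused.1 hi x) (fun x _ hx => ha ⟨x, hx⟩) hN,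
    ⟨y, by simp [replace]⟩, Finset.card_lt_card ?_⟩
  have hy : ¬ N i (F.left y) (F.right y) := fun hy =>
    ha ⟨y, h.matching.left_unique i _ _ _ hy hN⟩
  rw [Finset.ssubset_iff_of_subset]
  · exact ⟨y, Finset.mem_filter.2 ⟨Finset.mem_univ _, by simpa [replace] using hN⟩, by simpa using hy⟩
  · intro x hx
    simp only [Finset.mem_filter, Finset.mem_univ, true_and] at hx ⊢
    have hxy : x ≠ y := by rintro rfl; exact hy hx
    simpa [replace, hxy] using hx

-- If `F` is not tight, its edge of colour `i` can be recoloured with an unused colour. This frees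
-- `i`, and `exists_more_edges` then increases the number of edges in matching `i`, which is at most
-- `k`.
open Classical in
theorem exists_isTight_of_mem {i : ι} (hi : i ∈ Set.range F.color) :
    ∃ F' : RainbowMatching N (Fin k), F'.IsTight := by
  induction hm : k - (Finset.univ.filter fun x => N i (F.left x) (F.right x)).card
    using Nat.strong_induction_on generalizing F with
  | _ m ih =>
    by_cases hF : F.IsTight
    · exact ⟨F, hF⟩
    obtain ⟨x, rfl⟩ := hi
    simp only [IsTight, not_exists, not_forall, not_not] at hF
    obtain ⟨l, hl, hN⟩ := hF x
    have hlx := F.mem_unused.1 hl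
    let F₁ := F.replace x (fun z _ => hlx z) (fun z hz e => hz (F.left_inj e)) hN
    have h1 : F.color x ∈ F₁.unused := by
      rw [mem_unused]
      intro z
      by_cases hz : z = x
      · subst hz
        simpa [F₁, replace] using (hlx z).symm
      · simpa [F₁, replace, hz] using fun e => hz (F.color_inj e)
    obtain ⟨F₂, h2, h3⟩ := F₁.exists_more_edges h h1
    have h4 : F₁.left = F.left := by simp [F₁, replace]
    have h5 : F₁.right = F.right := rfl
    rw [h4, h5] at h3
    have h6 : (Finset.univ.filter fun z => N (F.color x) (F₂.left z) (F₂.right z)).card ≤ k :=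
      (Finset.card_filter_le _ _).trans (by simp)
    exact ih _ (by omega) F₂ h2 rfl

end

theorem _root_.ExtremalFamily.exists_isTight (h : ExtremalFamily N k) (hk : 0 < k) :
    ∃ F : RainbowMatching N (Fin k), F.IsTight := by
  obtain ⟨F⟩ := h.matching.exists_rainbowMatching h.card_eq le_rfl
  exact F.exists_isTight_of_mem h ⟨⟨0, hk⟩, rfl⟩

namespace IsTight

variable (h : ExtremalFamily N k) {F : RainbowMatching N (Fin k)} (hF : F.IsTight)
include h hF

theorem exists_list : ∃ l : List (Option (Fin k)), l.Nodup ∧ (∀ u, u ∈ l ↔ u ≠ none) ∧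
    ∀ i ∈ F.unused, List.IsChain (F.rel i) (none :: (l ++ [none])) := by
  obtain ⟨x, hx⟩ := hF
  obtain ⟨l, h1, h2, h3⟩ := (F.pathSystem' h).exists_list (F.card_erase_eq h) (f := some x)
    (by simp) (by
      rintro i hi ⟨a, b, rfl, rfl, hN⟩
      exact hx i hi hN)
  exact ⟨l, h1, by simpa using h2, h3⟩

theorem rel_of_rel {i j : ι} (hi : i ∈ F.unused) (hj : j ∈ F.unused) {u w : Option (Fin k)}
    (hu : F.rel i u w) : F.rel j u w := by
  obtain ⟨l, -, hl, hch⟩ := hF.exists_list h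
  have hmem : u ∈ none :: l := by
    rw [List.mem_cons, hl]
    exact em _
  obtain ⟨w', h1, h2⟩ := List.exists_rel_of_isChain hmem (hch i hi) (hch j hj)
  rwa [(F.pathSystem' h).out_unique' (F.card_erase_eq h) hi hu h1]

/-- Shift all edges of `F` along a matching with an unused colour. -/
theorem exists_shift {i : ι} (hi : i ∈ F.unused) :
    ∃ F' : RainbowMatching N (Fin k), F'.right = F.right ∧ (∀ j, j ∈ F'.unused ↔ j ∉ F.unused) ∧
      ∀ y, N i (F'.left y) (F.right y) := by
  choose α hα using F.exists_left h hi
  obtain ⟨a, x, ha, hx⟩ := F.exists_source h hi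
  have hcard : Fintype.card (Fin k) = Fintype.card F.unused := by
    rw [Fintype.card_coe, F.card_unused' h, Fintype.card_fin]
  let e₀ : Fin k ≃ F.unused := Fintype.equivOfCardEq hcard
  -- The contraction fixes an edge only if both ends are covered by `F`. The edge at `x` starts at
  -- an uncovered vertex, so it must keep colour `i`; the other colours are distributed arbitrarily.
  let e : Fin k ≃ F.unused := (Equiv.swap x (e₀.symm ⟨i, hi⟩)).trans e₀
  have hex : e x = ⟨i, hi⟩ := by simp [e]
  refine ⟨⟨α, F.right, fun y => e y, ?_, F.right_inj, ?_, ?_⟩, rfl, ?_, hα⟩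
  · intro y y' hy
    exact F.right_inj (h.matching.right_unique i _ _ _ (hα y) (hy ▸ hα y'))
  · exact Subtype.val_injective.comp e.injective
  · intro y
    by_cases hy : y = x
    · subst hy
      rw [hex]
      exact hα y
    obtain ⟨u, hu⟩ := exists_classifies F.left (α y)
    have hr : F.rel i u (some y) := ⟨α y, F.right y, hu, rfl, hα y⟩
    cases u with
    | none =>
      have hrx : F.rel i none (some x) := ⟨a, F.right x, ha, rfl, hx⟩
      have := (F.pathSystem' h).out_unique' (F.card_erase_eq h) hi hr hrx
      exact absurd (Option.some_injective _ this) hy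
    | some z =>
      obtain ⟨a', b', ha', hb', hN⟩ := hF.rel_of_rel h hi (e y).2 hr
      obtain rfl : α y = a' := Eq.trans hu (Eq.symm ha')
      obtain rfl : b' = F.right y := hb'
      exact hN
  · intro j
    rw [mem_unused]
    constructor
    · intro hj hjm
      exact hj (e.symm ⟨j, hjm⟩) (by simp)
    · rintro hj y rfl
      exact hj (e y).2

/-- After a shift the colour `d` is unused, and an unused colour meets every vertex of the rainbow
matching. Shifting on the other side keeps the left ends of `F`; shifting on this side brings in the
uncovered one. -/
theorem exists_right_of_edge {d i : ι} (hd : d ∉ F.unused) (hi : i ∈ F.unused) {a : A} {b : B}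
    (hN : N i a b) : ∃ b', N d a b' := by
  by_cases ha : a ∈ Set.range F.left
  · obtain ⟨x, rfl⟩ := ha
    obtain ⟨F', h1, h2, -⟩ := exists_shift h.swap hF.swap hi
    have := F'.swap.exists_right h ((h2 d).2 hd) x
    rwa [show F'.swap.left = F.left from h1] at this
  · have hb : b ∈ Set.range F.right := by
      by_contra hb
      exact (F.pathSystem' h).no_direct i hi ⟨a, b, ha, hb, hN⟩
    obtain ⟨y, rfl⟩ := hb
    obtain ⟨F', h1, h2, h3⟩ := hF.exists_shift h hi
    rw [h.matching.left_unique i _ _ _ hN (h3 y)]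
    exact F'.exists_right h ((h2 d).2 hd) y

/-- Two different uncovered ends together with the `k` left ends of `F` would give `k + 2` vertices
met by a matching of a used colour, which has only `k + 1` edges. -/
theorem source_unique {i j : ι} (hi : i ∈ F.unused) (hj : j ∈ F.unused) {a a' : A} {b b' : B}
    (ha : a ∉ Set.range F.left) (ha' : a' ∉ Set.range F.left) (hN : N i a b) (hN' : N j a' b') :
    a = a' := by
  classical
  obtain ⟨x, -⟩ := id hF
  have hd : F.color x ∉ F.unused := by simp
  obtain ⟨S, hS, hSN⟩ := h.matching.exists_edges (F.color x)
  by_contra hne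
  have hsub : insert a (insert a' (Finset.univ.image F.left)) ⊆ S.image Prod.fst := by
    have key : ∀ i ∈ F.unused, ∀ a b, N i a b → a ∈ S.image Prod.fst := by
      intro i hi a b hN
      obtain ⟨b', hb'⟩ := hF.exists_right_of_edge h hd hi hN
      exact Finset.mem_image.2 ⟨(a, b'), (hSN _).2 hb', rfl⟩
    intro c hc
    simp only [Finset.mem_insert, Finset.mem_image, Finset.mem_univ, true_and] at hc
    rcases hc with rfl | rfl | ⟨y, rfl⟩
    · exact key i hi _ _ hN
    · exact key j hj _ _ hN'
    · obtain ⟨b', hb'⟩ := F.exists_right h hi y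
      exact key i hi _ _ hb'
  have h1 := (Finset.card_le_card hsub).trans Finset.card_image_le
  rw [Finset.card_insert_of_notMem, Finset.card_insert_of_notMem,
    Finset.card_image_of_injective _ F.left_inj, Finset.card_univ, Fintype.card_fin, hS] at h1
  · omega
  · simpa using ha'
  · simpa [hne] using ha

theorem eq_of_classifies {i j : ι} (hi : i ∈ F.unused) (hj : j ∈ F.unused) {u : Option (Fin k)}
    {a a' : A} {b b' : B} (ha : Classifies F.left u a) (ha' : Classifies F.left u a')
    (hN : N i a b) (hN' : N j a' b') : a = a' := by
  cases u with
  | none => exact hF.source_unique h hi hj ha ha' hN hN'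
  | some x => exact ha.trans ha'.symm

/-- All matchings with unused colours coincide. -/
theorem edge_of_edge {i j : ι} (hi : i ∈ F.unused) (hj : j ∈ F.unused) {a : A} {b : B}
    (hN : N i a b) : N j a b := by
  obtain ⟨u, hu⟩ := exists_classifies F.left a
  obtain ⟨w, hw⟩ := exists_classifies F.right b
  obtain ⟨a', b', hu', hw', hN'⟩ := hF.rel_of_rel h hi hj ⟨a, b, hu, hw, hN⟩
  rw [hF.eq_of_classifies h hi hj hu hu' hN hN',
    eq_of_classifies h.swap hF.swap hi hj hw hw' hN hN']
  exact hN'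

end IsTight

end RainbowMatching

/-! ### The two halves of the family -/

/-- The structure of an extremal family: the vertices are `a u` and `b u`, the matchings of one half
of the family all join `a u` to `b u`, and those of the other half all join `a u` to `b w` where `w`
follows `u` in a fixed cyclic order. -/
theorem ExtremalFamily.exists_cyclic_order {ι A B : Type*} [Fintype ι] {N : ι → A → B → Prop}
    {k : ℕ} (h : ExtremalFamily N k) (hk : 0 < k) :
    ∃ (I : Finset ι) (a : Option (Fin k) → A) (b : Option (Fin k) → B) (l : List (Option (Fin k)))
      (R : Option (Fin k) → Option (Fin k) → Prop), I.card = k ∧ a.Injective ∧ b.Injective ∧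
      (none :: l).Nodup ∧ (∀ u, u ∈ none :: l) ∧ List.IsChain R (none :: (l ++ [none])) ∧
      (∀ u w w', R u w → R u w' → w = w') ∧
      (∀ i ∈ I, ∀ x y, N i x y ↔ ∃ u, x = a u ∧ y = b u) ∧
      (∀ i ∉ I, ∀ x y, N i x y ↔ ∃ u w, R u w ∧ x = a u ∧ y = b w) := by
  classical
  obtain ⟨F, hF⟩ := h.exists_isTight hk
  have hne : ∀ F : RainbowMatching N (Fin k), ∃ i, i ∈ F.unused := fun F =>
    Finset.card_pos.1 (by rwa [F.card_unused' h])
  obtain ⟨i₀, hi₀⟩ := hne F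
  obtain ⟨F', -, hcol, hshift⟩ : ∃ F' : RainbowMatching N (Fin k), F'.right = F.right ∧
    (∀ j, j ∈ F'.unused ↔ j ∉ F.unused) ∧ ∀ y, N i₀ (F'.left y) (F'.right y) := by
    obtain ⟨F', h1, h2, h3⟩ := hF.exists_shift h hi₀
    exact ⟨F', h1, h2, h1 ▸ h3⟩
  have hall : ∀ m ∈ F.unused, ∀ y, N m (F'.left y) (F'.right y) := fun m hm y =>
    hF.edge_of_edge h hi₀ hm (hshift y)
  -- If the edge of `F'` at 0 had an unused colour, recolouring would free its own colour, whose
  -- matching contains all edges of `F'`. Yet a freed colour must join some right end to an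
  -- uncovered vertex.
  have hF' : F'.IsTight := by
    refine ⟨⟨0, hk⟩, fun d hd hN => ?_⟩
    set x : Fin k := ⟨0, hk⟩
    have hd' := F'.mem_unused.1 hd
    let F₂ := F'.replace x (fun z _ => hd' z) (fun z hz e => hz (F'.left_inj e)) hN
    have hleft : F₂.left = F'.left := by simp [F₂, RainbowMatching.replace]
    have h1 : F'.color x ∈ F₂.unused := by
      rw [RainbowMatching.mem_unused]
      intro z
      by_cases hz : z = x
      · simpa [F₂, RainbowMatching.replace, hz] using (hd' x).symm
      · simpa [F₂, RainbowMatching.replace, hz] using fun e => hz (F'.color_inj e)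
    have h2 : F'.color x ∈ F.unused := by
      by_contra hc
      exact F'.mem_unused.1 ((hcol _).2 hc) x rfl
    obtain ⟨a, y, ha, hay⟩ := F₂.exists_source h h1
    exact ha ⟨y, hleft ▸ h.matching.left_unique _ _ _ _ (hall _ h2 y) hay⟩
  obtain ⟨l, hlnd, hl, hch⟩ := hF'.exists_list h
  obtain ⟨d₀, hd₀⟩ := hne F'
  obtain ⟨S, hS, hSN⟩ := h.matching.exists_edges i₀
  -- `p` is the one edge of matching `i₀` outside `F'`; its ends are the vertices labelled `none`.
  obtain ⟨p, hpS, hp⟩ : ∃ p ∈ S, p ∉ Finset.univ.image fun y => (F'.left y, F'.right y) := by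
    refine Finset.exists_mem_notMem_of_card_lt_card ?_
    refine Finset.card_image_le.trans_lt ?_
    rw [hS, Finset.card_univ, Fintype.card_fin]
    exact Nat.lt_succ_self k
  have hpN := (hSN p).1 hpS
  have hp1 : p.1 ∉ Set.range F'.left := by
    rintro ⟨y, hy⟩
    have := h.matching.right_unique _ _ _ _ (hy ▸ hshift y) hpN
    exact hp (Finset.mem_image.2 ⟨y, Finset.mem_univ _, Prod.ext hy this⟩)
  have hp2 : p.2 ∉ Set.range F'.right := by
    rintro ⟨y, hy⟩
    have := h.matching.left_unique _ _ _ _ (hy ▸ hshift y) hpN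
    exact hp (Finset.mem_image.2 ⟨y, Finset.mem_univ _, Prod.ext this hy⟩)
  let a : Option (Fin k) → A := fun u => u.elim p.1 F'.left
  let b : Option (Fin k) → B := fun u => u.elim p.2 F'.right
  have ha : a.Injective := Option.injective_iff.2 ⟨F'.left_inj, hp1⟩
  have hb : b.Injective := Option.injective_iff.2 ⟨F'.right_inj, hp2⟩
  have hab : ∀ u, N i₀ (a u) (b u) := by
    rintro (_ | y)
    exacts [hpN, hshift y]
  have himg : Finset.univ.image (fun u => (a u, b u)) = S := by
    refine Finset.eq_of_subset_of_card_le ?_ ?_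
    · intro q hq
      obtain ⟨u, -, rfl⟩ := Finset.mem_image.1 hq
      exact (hSN _).2 (hab u)
    · rw [Finset.card_image_of_injective _ fun u w huw => ha (Prod.mk.inj huw).1, hS,
        Finset.card_univ, Fintype.card_option, Fintype.card_fin]
  have hN₀ : ∀ x y, N i₀ x y ↔ ∃ u, x = a u ∧ y = b u := by
    intro x y
    rw [← hSN (x, y), ← himg]
    simp [eq_comm]
  have hi₀' : i₀ ∉ F'.unused := fun hc => (hcol _).1 hc hi₀
  -- By `exists_right_of_edge` the matching `i₀` meets every end of a `d₀`-edge, so an end uncovered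
  -- by `F'` is an end of `p`.
  have hAclass : ∀ u x y, Classifies F'.left u x → N d₀ x y → x = a u := by
    rintro u x y hu hN
    cases u with
    | some z => exact hu
    | none =>
      obtain ⟨y', hy'⟩ := hF'.exists_right_of_edge h hi₀' hd₀ hN
      obtain ⟨v, hv, -⟩ := (hN₀ _ _).1 hy'
      cases v with
      | none => exact hv
      | some z => exact absurd ⟨z, hv.symm⟩ hu
  have hBclass : ∀ w x y, Classifies F'.right w y → N d₀ x y → y = b w := by
    rintro w x y hw hN
    cases w with
    | some z => exact hw
    | none =>
      obtain ⟨x', hx'⟩ := hF'.swap.exists_right_of_edge h.swap hi₀' hd₀ hN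
      obtain ⟨v, -, hv⟩ := (hN₀ _ _).1 hx'
      cases v with
      | none => exact hv
      | some z => exact absurd ⟨z, hv.symm⟩ hw
  refine ⟨F.unused, a, b, l, F'.rel d₀, F.card_unused' h, ha, hb,
    List.nodup_cons.2 ⟨by simp [hl], hlnd⟩, fun u => ?_, hch _ hd₀,
    fun u w w' => (F'.pathSystem' h).out_unique' (F'.card_erase_eq h) hd₀, ?_, ?_⟩
  · rw [List.mem_cons, hl]
    exact em _
  · intro i hi x y
    rw [← hN₀]
    exact ⟨hF.edge_of_edge h hi hi₀, hF.edge_of_edge h hi₀ hi⟩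
  · intro i hi x y
    have hi' := (hcol i).2 hi
    constructor
    · intro hN
      replace hN := hF'.edge_of_edge h hi' hd₀ hN
      obtain ⟨u, hu⟩ := exists_classifies F'.left x
      obtain ⟨w, hw⟩ := exists_classifies F'.right y
      exact ⟨u, w, ⟨x, y, hu, hw, hN⟩, hAclass u x y hu hN, hBclass w x y hw hN⟩
    · rintro ⟨u, w, ⟨x', y', hu, hw, hN⟩, rfl, rfl⟩
      rw [← hAclass u x' y' hu hN, ← hBclass w x' y' hw hN]
      exact hF'.edge_of_edge h hd₀ hi' hN

/-! ### From relations back to graphs, walks and edge sets -/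

namespace SimpleGraph

variable {V : Type*} {G : SimpleGraph V}

theorem Walk.evenEdges_cons {u v w : V} (h : G.Adj u v) (p : G.Walk v w) :
    (Walk.cons h p).evenEdges = insert s(u, v) p.oddEdges := by
  ext e
  simp only [Walk.evenEdges, Walk.oddEdges, Walk.edges_cons, Set.mem_ofPred_eq, Set.mem_insert_iff]
  constructor
  · rintro ⟨k, hk, he⟩
    cases k with
    | zero => exact Or.inl (by simpa [eq_comm] using he)
    | succ k => exact Or.inr ⟨k, by simpa [Nat.even_add_one] using hk, by simpa using he⟩
  · rintro (rfl | ⟨k, hk, he⟩)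
    · exact ⟨0, by simp, by simp⟩
    · exact ⟨k + 1, by simpa [Nat.even_add_one] using hk, by simpa using he⟩

theorem Walk.oddEdges_cons {u v w : V} (h : G.Adj u v) (p : G.Walk v w) :
    (Walk.cons h p).oddEdges = p.evenEdges := by
  ext e
  simp only [Walk.evenEdges, Walk.oddEdges, Walk.edges_cons, Set.mem_ofPred_eq]
  constructor
  · rintro ⟨k, hk, he⟩
    cases k with
    | zero => simp at hk
    | succ k => exact ⟨k, by simpa [Nat.odd_add_one] using hk, by simpa using he⟩
  · rintro ⟨k, hk, he⟩
    exact ⟨k + 1, by simpa [Nat.odd_add_one] using hk, by simpa using he⟩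

theorem Walk.evenEdges_union_oddEdges {u v : V} (p : G.Walk u v) :
    p.evenEdges ∪ p.oddEdges = p.edgeSet := by
  ext e
  simp only [Walk.evenEdges, Walk.oddEdges, Set.mem_union, Set.mem_ofPred_eq, Walk.edgeSet,
    List.mem_iff_getElem?]
  constructor
  · rintro (⟨k, -, h⟩ | ⟨k, -, h⟩) <;> exact ⟨k, h⟩
  · rintro ⟨k, h⟩
    exact (Nat.even_or_odd k).imp (fun hk => ⟨k, hk, h⟩) fun hk => ⟨k, hk, h⟩

/-- Each point `q` of the chain contributes the edge from `b q` to `a q` and then the edge to the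
next `b r`. The two nodup hypotheses are separate so that the induction can move `u` along the chain
while `o` stays fixed; for a closed chain `u = o`. -/
theorem exists_alternating_walk {Q : Type*} {a b : Q → V} {R : Q → Q → Prop}
    (ha : a.Injective) (hb : b.Injective) (hne : ∀ q r, a q ≠ b r)
    (hab : ∀ q, G.Adj (b q) (a q)) (hR : ∀ q r, R q r → G.Adj (a q) (b r))
    (hfun : ∀ q r r', R q r → R q r' → r = r') {o : Q} {l : List Q} {u : Q}
    (hch : List.IsChain R (u :: (l ++ [o]))) (hl : (u :: l).Nodup) (ho : (l ++ [o]).Nodup) :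
    ∃ c : G.Walk (b u) (b o), c.length = 2 * (l.length + 1) ∧ c.support.tail.Nodup ∧
      (∀ v ∈ c.support.tail, (∃ q ∈ u :: l, v = a q) ∨ ∃ q ∈ l ++ [o], v = b q) ∧
      c.evenEdges = {e | ∃ q ∈ u :: l, e = s(a q, b q)} ∧
      c.oddEdges = {e | ∃ q ∈ u :: l, ∃ r, R q r ∧ e = s(a q, b r)} := by
  have hodd : ∀ q r, R q r → {e | ∃ r, R q r ∧ e = s(a q, b r)} = {s(a q, b r)} := by
    intro q r hqr
    ext e
    simp only [Set.mem_ofPred_eq, Set.mem_singleton_iff]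
    constructor
    · rintro ⟨r', hr', rfl⟩
      rw [hfun q r' r hr' hqr]
    · rintro rfl
      exact ⟨r, hqr, rfl⟩
  induction l generalizing u with
  | nil =>
    simp only [List.nil_append, List.isChain_cons_cons, List.isChain_singleton, and_true] at hch
    refine ⟨.cons (hab u) (.cons (hR u o hch) .nil), by simp, ?_, ?_, ?_, ?_⟩
    · simpa using hne u o
    · simp
    · rw [Walk.evenEdges_cons, Walk.oddEdges_cons]
      ext e
      simp [Walk.evenEdges, Sym2.eq_swap]
    · rw [Walk.oddEdges_cons, Walk.evenEdges_cons]
      simp [hodd u o hch, Walk.oddEdges]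
  | cons w l ih =>
    simp only [List.cons_append, List.isChain_cons_cons] at hch
    rw [List.nodup_cons] at hl
    rw [List.cons_append, List.nodup_cons] at ho
    obtain ⟨c, h1, h2, h3, h4, h5⟩ := ih (by simpa using hch.2) hl.2 ho.2
    have hsup : c.support = b w :: c.support.tail := c.cons_tail_support.symm
    refine ⟨.cons (hab u) (.cons (hR u w hch.1) c), ?_, ?_, ?_, ?_, ?_⟩
    · simp [h1]; ring
    · simp only [Walk.support_cons, List.tail_cons]
      rw [hsup]
      simp only [List.nodup_cons, List.mem_cons, not_or]
      refine ⟨⟨hne u w, fun hc => ?_⟩, fun hc => ?_, h2⟩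
      · rcases h3 _ hc with ⟨q, hq, e⟩ | ⟨q, hq, e⟩
        · exact hl.1 (ha e ▸ hq)
        · exact hne _ _ e
      · rcases h3 _ hc with ⟨q, hq, e⟩ | ⟨q, hq, e⟩
        · exact hne _ _ e.symm
        · exact ho.1 (hb e ▸ hq)
    · intro v hv
      simp only [Walk.support_cons, List.tail_cons] at hv
      rw [hsup, List.mem_cons, List.mem_cons] at hv
      rcases hv with rfl | rfl | hv
      · exact Or.inl ⟨u, by simp, rfl⟩
      · exact Or.inr ⟨w, by simp, rfl⟩
      · rcases h3 v hv with ⟨q, hq, e⟩ | ⟨q, hq, e⟩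
        · exact Or.inl ⟨q, List.mem_cons_of_mem _ hq, e⟩
        · exact Or.inr ⟨q, List.mem_cons_of_mem _ hq, e⟩
    · rw [Walk.evenEdges_cons, Walk.oddEdges_cons, h4]
      ext e
      simp only [List.mem_cons (a := _) (b := u), exists_eq_or_imp, Set.mem_insert_iff,
        Set.mem_ofPred_eq, Sym2.eq_swap (a := b u)]
    · rw [Walk.oddEdges_cons, Walk.evenEdges_cons, h5]
      have := hodd u w hch.1
      ext e
      have he : (∃ r, R u r ∧ e = s(a u, b r)) ↔ e = s(a u, b w) := Set.ext_iff.1 this e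
      simp only [List.mem_cons (b := u), exists_eq_or_imp, Set.mem_insert_iff,
        Set.mem_ofPred_eq, he]

/-- The edges of a subgraph, directed from the first class of a 2-colouring to the second. -/
def Subgraph.crossing (C : G.Coloring (Fin 2)) (M : G.Subgraph) (a b : V) : Prop :=
  M.Adj a b ∧ C a = 0

theorem Subgraph.crossing_color_right {C : G.Coloring (Fin 2)} {M : G.Subgraph} {a b : V}
    (h : M.crossing C a b) : C b = 1 := by
  have h1 := C.valid h.1.adj_sub
  have h2 := h.2
  omega

theorem Subgraph.edgeSet_eq_crossing (C : G.Coloring (Fin 2)) (M : G.Subgraph) :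
    M.edgeSet = (fun p : V × V => s(p.1, p.2)) '' {p | M.crossing C p.1 p.2} := by
  ext e
  induction e using Sym2.ind with
  | _ x y =>
    rw [Subgraph.mem_edgeSet]
    constructor
    · intro h
      have h1 := C.valid h.adj_sub
      by_cases hx : C x = 0
      · exact ⟨(x, y), ⟨h, hx⟩, rfl⟩
      · exact ⟨(y, x), ⟨h.symm, by dsimp only; omega⟩, Sym2.eq_swap⟩
    · rintro ⟨p, hp, he⟩
      rw [← Subgraph.mem_edgeSet, ← he]
      exact hp.1

theorem Subgraph.crossing_injOn (C : G.Coloring (Fin 2)) (M : G.Subgraph) :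
    Set.InjOn (fun p : V × V => s(p.1, p.2)) {p | M.crossing C p.1 p.2} := by
  rintro ⟨x, y⟩ hp ⟨z, w⟩ hq h
  simp only [Sym2.eq_iff] at h
  rcases h with ⟨rfl, rfl⟩ | ⟨rfl, rfl⟩
  · rfl
  · have h1 := crossing_color_right hp
    have h2 : C y = 0 := hq.2
    simp [h2] at h1

theorem matchingFamily_crossing {ι : Type*} (C : G.Coloring (Fin 2)) {M : ι → G.Subgraph} {n : ℕ}
    (hn : n ≠ 0) (hM : ∀ i, (M i).IsMatching) (hcard : ∀ i, (M i).edgeSet.ncard = n) :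
    MatchingFamily (fun i => (M i).crossing C) n where
  right_unique i a b b' h h' := (hM i).eq_of_adj_left h.1 h'.1
  left_unique i a a' b h h' := (hM i).eq_of_adj_right h.1 h'.1
  exists_edges i := by
    have h1 : {p : V × V | (M i).crossing C p.1 p.2}.ncard = n := by
      rw [← hcard i, (M i).edgeSet_eq_crossing C, ((M i).crossing_injOn C).ncard_image]
    have hfin := Set.finite_of_ncard_ne_zero (h1.trans_ne hn)
    refine ⟨hfin.toFinset, ?_, fun p => by simp⟩
    rw [← h1, Set.ncard_eq_toFinset_card _ hfin]

theorem hasRainbowMatching_of_rainbowMatching {ι J : Type*} [Fintype J] {C : G.Coloring (Fin 2)}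
    {M : ι → G.Subgraph} (F : RainbowMatching (fun i => (M i).crossing C) J) :
    HasRainbowMatching M (Fintype.card J) := by
  have hl : ∀ x, C (F.left x) = 0 := fun x => (F.edge x).2
  have hr : ∀ x, C (F.right x) = 1 := fun x => Subgraph.crossing_color_right (F.edge x)
  have hlr : ∀ x y, F.left x ≠ F.right y := fun x y h => by
    have h1 := hl x
    rw [h, hr] at h1
    simp at h1
  let H : G.Subgraph :=
    { verts := Set.range F.left ∪ Set.range F.right
      Adj := fun v w => ∃ x, s(F.left x, F.right x) = s(v, w)
      adj_sub := by
        rintro v w ⟨x, hx⟩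
        have := (F.edge x).1.adj_sub
        rwa [← mem_edgeSet, hx] at this
      edge_vert := by
        rintro v w ⟨x, hx⟩
        rcases Sym2.eq_iff.1 hx with ⟨rfl, -⟩ | ⟨-, rfl⟩
        · exact Or.inl ⟨x, rfl⟩
        · exact Or.inr ⟨x, rfl⟩
      symm := ⟨by
        rintro v w ⟨x, hx⟩
        exact ⟨x, hx.trans Sym2.eq_swap⟩⟩ }
  have hinj : Function.Injective fun x => s(F.left x, F.right x) := by
    intro x y h
    rcases Sym2.eq_iff.1 h with ⟨h, -⟩ | ⟨h, -⟩
    · exact F.left_inj h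
    · exact absurd h (hlr _ _)
  have hE : H.edgeSet = Set.range fun x => s(F.left x, F.right x) := by
    ext e
    induction e using Sym2.ind with
    | _ v w => rfl
  refine ⟨H, ?_, ?_, ?_, ?_⟩
  · rintro v (⟨x, rfl⟩ | ⟨x, rfl⟩)
    · refine ⟨F.right x, ⟨x, rfl⟩, ?_⟩
      rintro w ⟨y, hy⟩
      rcases Sym2.eq_iff.1 hy with ⟨h, rfl⟩ | ⟨-, h⟩
      · rw [F.left_inj h]
      · exact absurd h.symm (hlr _ _)
    · refine ⟨F.left x, ⟨x, Sym2.eq_swap⟩, ?_⟩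
      rintro w ⟨y, hy⟩
      rcases Sym2.eq_iff.1 hy with ⟨h, -⟩ | ⟨rfl, h⟩
      · exact absurd h (hlr _ _)
      · rw [F.right_inj h]
  · rw [hE, Set.ncard_range_of_injective hinj, Nat.card_eq_fintype_card]
  · rw [hE]
    exact Set.finite_range _
  · have hc : ∀ i : Set.range F.color, ∃ x, F.color x = i := fun i => i.2
    choose g hg using hc
    refine ⟨Set.range F.color, fun i => s(F.left (g i), F.right (g i)), ?_, ?_, ?_⟩
    · intro i j hij
      apply Subtype.ext
      rw [← hg i, ← hg j, hinj hij]
    · intro i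
      rw [Subgraph.mem_edgeSet]
      exact hg i ▸ (F.edge (g i)).1
    · rw [hE]
      ext e
      constructor
      · rintro ⟨i, rfl⟩
        exact ⟨g i, rfl⟩
      · rintro ⟨x, rfl⟩
        have hx : F.color x ∈ Set.range F.color := ⟨x, rfl⟩
        refine ⟨⟨F.color x, hx⟩, ?_⟩
        dsimp only
        rw [F.color_inj (hg ⟨F.color x, hx⟩)]

end SimpleGraph

/-! ### Assembling the cycle -/

theorem mainTheorem1 {V : Type*} (G : SimpleGraph V) (hG : G.IsBipartite)
    (n : ℕ) (hn : 2 ≤ n) (M : Fin (2 * n - 2) → G.Subgraph)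
    (hM : ∀ i, (M i).IsMatching) (hcard : ∀ i, (M i).edgeSet.ncard = n)
    (hno : ¬ SimpleGraph.HasRainbowMatching M n) :
    ∃ (u : V) (c : G.Walk u u), c.IsCycle ∧ c.length = 2 * n ∧
      (⋃ i, (M i).edgeSet) = c.edgeSet ∧
      ∃ I : Finset (Fin (2 * n - 2)), I.card = n - 1 ∧ Iᶜ.card = n - 1 ∧
        (∀ i ∈ I, (M i).edgeSet = c.evenEdges) ∧
        (∀ i ∈ Iᶜ, (M i).edgeSet = c.oddEdges) := by
  obtain ⟨C⟩ := hG
  have hk : n = n - 1 + 1 := by omega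
  have hext : ExtremalFamily (fun i => (M i).crossing C) (n - 1) := by
    refine ⟨hk ▸ SimpleGraph.matchingFamily_crossing C (by omega) hM hcard, ?_, ⟨fun F => hno ?_⟩⟩
    · rw [Fintype.card_fin]; omega
    · have := SimpleGraph.hasRainbowMatching_of_rainbowMatching F
      rwa [Fintype.card_option, Fintype.card_fin, ← hk] at this
  obtain ⟨I, a, b, l, R, hI, ha, hb, hnd, hmem, hch, hfun, hN, hN'⟩ :=
    hext.exists_cyclic_order (by omega)
  have hIc : Iᶜ.card = n - 1 := by
    rw [Finset.card_compl, Fintype.card_fin, hI]; omega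
  obtain ⟨i, hi⟩ : I.Nonempty := Finset.card_pos.1 (by omega)
  obtain ⟨j, hj⟩ : Iᶜ.Nonempty := Finset.card_pos.1 (by omega)
  have hij : ∀ q, (M i).crossing C (a q) (b q) := fun q => (hN i hi _ _).2 ⟨q, rfl, rfl⟩
  have hR : ∀ q r, R q r → G.Adj (a q) (b r) := fun q r hqr =>
    ((hN' j (Finset.mem_compl.1 hj) _ _).2 ⟨q, r, hqr, rfl, rfl⟩).1.adj_sub
  have hne : ∀ q r, a q ≠ b r := fun q r h => by
    have h1 := (hij q).2
    rw [h, SimpleGraph.Subgraph.crossing_color_right (hij r)] at h1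
    simp at h1
  have hnd' : (l ++ [none]).Nodup := by
    rw [← List.concat_eq_append, List.nodup_concat]
    exact List.nodup_cons.1 hnd
  obtain ⟨c, hlen, hsup, -, heven, hodd⟩ := SimpleGraph.exists_alternating_walk ha hb hne
    (fun q => (hij q).1.adj_sub.symm) hR hfun hch hnd hnd'
  have hll : l.length + 1 = n := by
    classical
    have h1 := List.toFinset_card_of_nodup hnd
    have h2 : (none :: l).toFinset = Finset.univ := by
      ext u
      simpa using hmem u
    rw [h2, Finset.card_univ, Fintype.card_option, Fintype.card_fin, ← hk] at h1
    exact h1.symm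
  have hE : ∀ i ∈ I, (M i).edgeSet = c.evenEdges := by
    intro i hi
    rw [heven, (M i).edgeSet_eq_crossing C]
    ext e
    constructor
    · rintro ⟨p, hp, rfl⟩
      obtain ⟨q, h1, h2⟩ := (hN i hi _ _).1 hp
      exact ⟨q, hmem q, by rw [← h1, ← h2]⟩
    · rintro ⟨q, -, rfl⟩
      exact ⟨(a q, b q), (hN i hi _ _).2 ⟨q, rfl, rfl⟩, rfl⟩
  have hO : ∀ i ∈ Iᶜ, (M i).edgeSet = c.oddEdges := by
    intro i hi
    have hi := Finset.mem_compl.1 hi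
    rw [hodd, (M i).edgeSet_eq_crossing C]
    ext e
    constructor
    · rintro ⟨p, hp, rfl⟩
      obtain ⟨q, r, hqr, h1, h2⟩ := (hN' i hi _ _).1 hp
      exact ⟨q, hmem q, r, hqr, by rw [← h1, ← h2]⟩
    · rintro ⟨q, -, r, hqr, rfl⟩
      exact ⟨(a q, b r), (hN' i hi _ _).2 ⟨q, r, hqr, rfl, rfl⟩, rfl⟩
  refine ⟨b none, c, ?_, by rw [hlen, hll], ?_, I, hI, hIc, hE, hO⟩
  · rw [SimpleGraph.Walk.isCycle_iff_isPath_tail_and_le_length]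
    refine ⟨?_, by omega⟩
    rw [SimpleGraph.Walk.isPath_def, SimpleGraph.Walk.support_tail_of_not_nil]
    · exact hsup
    · rw [← SimpleGraph.Walk.length_eq_zero_iff]
      omega
  · rw [← c.evenEdges_union_oddEdges]
    refine Set.Subset.antisymm (Set.iUnion_subset fun m => ?_) (Set.union_subset ?_ ?_)
    · by_cases hm : m ∈ I
      · exact (hE m hm).subset.trans Set.subset_union_left
      · exact (hO m (Finset.mem_compl.2 hm)).subset.trans Set.subset_union_right
    · rw [← hE i hi]
      exact Set.subset_iUnion (fun m => (M m).edgeSet) i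
    · rw [← hO j hj]
      exact Set.subset_iUnion (fun m => (M m).edgeSet) j
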